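/- Let a (discrete) group $G$ act by homeomorphisms on a compact Hausdorff space $\widetilde T$ so that the action is 3-discontinuous, i.e. the induced action on the space of 3-element subsets of $\widetilde T$ is properly discontinuous. For a subgroup $H\le G$ (including $H=G$) let the discontinuity domain of $H$ be the set of points $x\in\widetilde T$ having a neighbourhood $U$ with $hU\cap U\neq\varnothing$ for only finitely many $h\in H$, and let the limit set $\Lambda(H)$ be its complement. Put $T=\Lambda(G)$ and $A=\widetilde T\setminus T$, and assume that $A$ is discrete and meets only finitely many $G$-orbits. Let $H\le G$ be a dynamically bounded subgroup: every infinite set $S\subset G$ of elements representing pairwise distinct cosets $gH$ contains an infinite subset $S_0$ such that $T\setminus\bigcup_{s\in S_0}s(\Lambda(H))$ has non-empty interior in $T$. If $H$ acts cocompactly on $T\setminus\Lambda(H)$, then $H$ acts cocompactly on $\widetilde T\setminus\Lambda(H)$. (Here $H$ acts cocompactly on an $H$-invariant subset $Y\subset\widetilde T$ if $Y=\bigcup_{h\in H}hK$ for some compact $K\subset Y$.) The action of $G$ is not assumed to be 2-cocompact, and $G$ is not assumed to be finitely generated. -/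

import Mathlib

open scoped Pointwise

/-- The topology of the space `Θⁿ X` of `n`-element subsets of `X`: the quotient topology of the
space of injective maps `Fin n → X` (which carries the topology induced from `Xⁿ`), under the map
sending an injective map to its image. -/
abbrev thetaTopology (X : Type*) [TopologicalSpace X] (n : ℕ) :
    TopologicalSpace (Set.powersetCard X n) :=
  TopologicalSpace.coinduced (Set.powersetCard.ofFinEmb n X)
    (TopologicalSpace.induced (fun f : Fin n ↪ X => (f : Fin n → X)) inferInstance)

open Classical in
/-- The action of `G` on `X` is 3-discontinuous: the induced action on the space `Θ³ X` of
3-element subsets of `X` is properly discontinuous. -/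
def IsThreeDiscontinuous (G X : Type*) [Group G] [TopologicalSpace X] [MulAction G X] : Prop :=
  @ProperlyDiscontinuousSMul G (Set.powersetCard X 3) (thetaTopology X 3) inferInstance

/-- The discontinuity domain: the points that have a neighbourhood `U` such that `g U` meets `U`
for only finitely many `g`. -/
def discontinuityDomain (G X : Type*) [Group G] [TopologicalSpace X] [MulAction G X] : Set X :=
  {x | ∃ U ∈ nhds x, {g : G | (g • U ∩ U).Nonempty}.Finite}

/-- The limit set: the complement of the discontinuity domain. -/
def limitSet (G X : Type*) [Group G] [TopologicalSpace X] [MulAction G X] : Set X :=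
  (discontinuityDomain G X)ᶜ

/-- A subset `M` of a `G`-set is `G`-finite if it meets only finitely many `G`-orbits. -/
def IsGFinite (G : Type*) {X : Type*} [Group G] [MulAction G X] (M : Set X) : Prop :=
  {o : Set X | ∃ x ∈ M, o = MulAction.orbit G x}.Finite

/-- `G` acts cocompactly on the (invariant) subset `Y`: some compact subset `K` of `Y` has
translates that cover `Y`. -/
def ActsCocompactlyOn (G : Type*) {X : Type*} [Group G] [TopologicalSpace X] [MulAction G X]
    (Y : Set X) : Prop :=
  ∃ K : Set X, IsCompact K ∧ ⋃ g : G, g • K = Y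

/-- `H ≤ G` is dynamically bounded: every infinite set `S` of elements of `G` that are pairwise
distinct modulo `H` contains an infinite subset `S₀` such that the complement in `T = limitSet G X`
of the union of the translates `s (limitSet H X)`, `s ∈ S₀`, has non-empty interior with respect
to the topology of `T`. -/
def IsDynamicallyBounded (X : Type*) {G : Type*} [Group G] [TopologicalSpace X] [MulAction G X]
    (H : Subgroup G) : Prop :=
  ∀ S : Set G, S.Infinite → Set.InjOn (fun g : G => (g : G ⧸ H)) S →
    ∃ S₀ ⊆ S, S₀.Infinite ∧
      (interior {t : limitSet G X | (t : X) ∉ ⋃ s ∈ S₀, s • limitSet H X}).Nonempty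

open Filter Topology

/-! Write Λ for `limitSet H X`. Fatten a compact set whose `H`-translates cover `T \ Λ` to a compact
`N` off Λ; the translates of its interior form an open `H`-invariant set `V` containing `T \ Λ`. It
remains to show that `A \ V` is `H`-finite.

If not, some orbit `G a` has infinitely many points in `A \ V` in distinct `H`-orbits. Dynamical
boundedness and corrections by `H` yield distinct `γ i` and a point `w` of `T` such that `γ i w`
stays in a compact subset of `T \ Λ`, `γ i a` stays outside `V`, and all `(γ i)⁻¹ Λ` avoid one
neighbourhood of `w`. The convergence property (`exists_attracting_repelling`) puts the attracting
point `p` in Λ and makes `w` the repelling point, which forces Λ = {p}. That parabolic case is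
excluded by conjugating `H` by `γ i` (`false_of_escaping_orbit`). -/

theorem isOpen_setOf_injective_fin {X : Type*} [TopologicalSpace X] [T2Space X] (n : ℕ) : IsOpen {f : Fin n → X | Function.Injective f} := by
  have : {f : Fin n → X | Function.Injective f} =
      ⋂ i : Fin n, ⋂ j : Fin n, ⋂ _ : i ≠ j, {f | f i ≠ f j} := by
    ext f
    simp only [Set.mem_ofPred_eq, Set.mem_iInter]
    exact ⟨fun h i j hij => h.ne hij, fun h i j hij => by_contra fun hne => h i j hne hij⟩
  rw [this]
  refine isOpen_iInter_of_finite fun i => isOpen_iInter_of_finite fun j =>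
    isOpen_iInter_of_finite fun _ => ?_
  exact isOpen_ne_fun (continuous_apply i) (continuous_apply j)

theorem Ultrafilter.exists_tendsto {I X : Type*} [TopologicalSpace X] [CompactSpace X] (l : Ultrafilter I) (u : I → X) :
    ∃ x, Tendsto u l (𝓝 x) :=
  ⟨(l.map u).lim, (l.map u).le_nhds_lim⟩

theorem tendsto_inv_cofinite {I G : Type*} [Group G] {l : Filter I} {γ : I → G}
    (hγ : Tendsto γ l cofinite) : Tendsto (fun i => (γ i)⁻¹) l cofinite :=
  inv_injective.tendsto_cofinite.comp hγ

instance Subgroup.continuousConstSMul {G X : Type*} [Group G] [TopologicalSpace X] [MulAction G X]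
    [ContinuousConstSMul G X] (H : Subgroup G) : ContinuousConstSMul H X :=
  ⟨fun h => continuous_const_smul (h : G)⟩

/-- Along `l` the elements `γ i` collapse the complement of the repelling point `q` to the
attracting point `p`. -/
def IsCollapsing {G X I : Type*} [TopologicalSpace X] [SMul G X] (l : Filter I) (γ : I → G)
    (p q : X) : Prop :=
  ∀ (u : I → X) (x y : X), Tendsto u l (𝓝 x) → Tendsto (fun i => γ i • u i) l (𝓝 y) →
    x = q ∨ y = p

/-- Moving points `u i` make the condition symmetric in source and target. -/
theorem IsCollapsing.inv {G X I : Type*} [Group G] [TopologicalSpace X] [MulAction G X]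
    {l : Filter I} {γ : I → G} {p q : X} (h : IsCollapsing l γ p q) :
    IsCollapsing l (fun i => (γ i)⁻¹) q p := by
  intro u x y hu hv
  exact (h (fun i => (γ i)⁻¹ • u i) y x hv (by simpa using hu)).symm

/-! ### Limit sets and compact families of triples -/

section LimitSet

variable {G X : Type*} [Group G] [TopologicalSpace X] [MulAction G X]

theorem isOpen_discontinuityDomain : IsOpen (discontinuityDomain G X) := by
  refine isOpen_iff_mem_nhds.2 fun x ⟨U, hU, hfin⟩ => ?_
  filter_upwards [eventually_mem_nhds_iff.2 hU] with y hy
  exact ⟨U, hy, hfin⟩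

theorem isClosed_limitSet : IsClosed (limitSet G X) :=
  isOpen_discontinuityDomain.isClosed_compl

theorem smul_mem_discontinuityDomain [ContinuousConstSMul G X] (g : G) {x : X}
    (hx : x ∈ discontinuityDomain G X) : g • x ∈ discontinuityDomain G X := by
  obtain ⟨U, hU, hfin⟩ := hx
  refine ⟨g • U, smul_mem_nhds_smul g hU, ?_⟩
  refine (hfin.image fun h => g * h * g⁻¹).subset ?_
  rintro k ⟨y, ⟨z, ⟨u, hu, rfl⟩, rfl⟩, v, hv, hvu⟩
  refine ⟨g⁻¹ * k * g, ⟨v, ⟨u, hu, ?_⟩, hv⟩, by group⟩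
  simp only at hvu ⊢
  rw [mul_smul, mul_smul, ← hvu, inv_smul_smul]

theorem smul_mem_discontinuityDomain_iff [ContinuousConstSMul G X] (g : G) {x : X} :
    g • x ∈ discontinuityDomain G X ↔ x ∈ discontinuityDomain G X :=
  ⟨fun h => by simpa using smul_mem_discontinuityDomain g⁻¹ h, smul_mem_discontinuityDomain g⟩

theorem smul_mem_limitSet_iff [ContinuousConstSMul G X] (g : G) {x : X} :
    g • x ∈ limitSet G X ↔ x ∈ limitSet G X :=
  not_congr (smul_mem_discontinuityDomain_iff g)

theorem discontinuityDomain_subset_subgroup (H : Subgroup G) :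
    discontinuityDomain G X ⊆ discontinuityDomain H X := by
  rintro x ⟨U, hU, hfin⟩
  exact ⟨U, hU, Set.Finite.preimage (f := ((↑) : H → G)) Subtype.val_injective.injOn hfin⟩

theorem limitSet_subgroup_subset (H : Subgroup G) : limitSet H X ⊆ limitSet G X :=
  Set.compl_subset_compl.2 (discontinuityDomain_subset_subgroup H)

theorem infinite_of_limitSet_nonempty (h : (limitSet G X).Nonempty) : Infinite G := by
  by_contra hG
  rw [not_infinite_iff_finite] at hG
  obtain ⟨x, hx⟩ := h
  exact hx ⟨Set.univ, univ_mem, Set.toFinite _⟩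

/-- A limit of an orbit along group elements that leave every finite set lies in the limit set. -/
theorem mem_limitSet_of_tendsto {I : Type*} {l : Filter I} [l.NeBot] {γ : I → G}
    (hγ : Tendsto γ l cofinite) {x y : X} (h : Tendsto (fun i => γ i • x) l (𝓝 y)) :
    y ∈ limitSet G X := by
  rintro ⟨U, hU, hfin⟩
  have hev : ∀ᶠ i in l, γ i • x ∈ U := h hU
  obtain ⟨j, hj⟩ := hev.exists
  have hfin' := (hfin.image fun g => g * γ j)
  obtain ⟨i, hi, hi'⟩ := (hev.and (hγ hfin'.compl_mem_cofinite)).exists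
  refine hi' ⟨γ i * (γ j)⁻¹, ⟨γ i • x, ⟨γ j • x, hj, ?_⟩, hi⟩, by group⟩
  simp [mul_smul]

/-- Forgetting the order of a triple is continuous and equivariant, so compact sets of ordered
triples map to compact sets in `Θ³ X`. -/
theorem IsThreeDiscontinuous.finite_of_isCompact (h3 : IsThreeDiscontinuous G X)
    {K L : Set (Fin 3 → X)} (hK : IsCompact K) (hL : IsCompact L)
    (hK' : ∀ f ∈ K, Function.Injective f) (hL' : ∀ f ∈ L, Function.Injective f) :
    {g : G | ∃ f ∈ K, g • f ∈ L}.Finite := by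
  classical
  let tE : TopologicalSpace (Fin 3 ↪ X) :=
    TopologicalSpace.induced (fun f : Fin 3 ↪ X => (f : Fin 3 → X)) inferInstance
  let tT : TopologicalSpace (Set.powersetCard X 3) := thetaTopology X 3
  have hind : IsInducing (fun f : Fin 3 ↪ X => (f : Fin 3 → X)) := ⟨rfl⟩
  have hcont : Continuous (Set.powersetCard.ofFinEmb 3 X) := continuous_coinduced_rng
  have key : ∀ M : Set (Fin 3 → X), IsCompact M → (∀ f ∈ M, Function.Injective f) →
      IsCompact (Set.powersetCard.ofFinEmb 3 X '' {e | (e : Fin 3 → X) ∈ M}) := by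
    intro M hM hM'
    refine IsCompact.image ?_ hcont
    rw [hind.isCompact_iff]
    convert hM
    ext f
    exact ⟨by rintro ⟨e, he, rfl⟩; exact he, fun hf => ⟨⟨f, hM' f hf⟩, hf, rfl⟩⟩
  have hfin := h3.finite_disjoint_inter_image (key K hK hK') (key L hL hL')
  refine hfin.subset ?_
  rintro g ⟨f, hf, hgf⟩
  refine ⟨Set.powersetCard.ofFinEmb 3 X ⟨g • f, hL' _ hgf⟩, ⟨_, ⟨⟨f, hK' f hf⟩, hf, rfl⟩, ?_⟩,
    ⟨⟨g • f, hL' _ hgf⟩, hgf, rfl⟩⟩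
  refine Subtype.ext (Finset.ext fun y => ?_)
  simp [Set.powersetCard.ofFinEmb, Finset.mem_smul_finset]

end LimitSet

/-! ### The convergence property -/

section Convergence

variable {G X : Type*} [Group G] [TopologicalSpace X] [CompactSpace X] [T2Space X] [MulAction G X]

theorem exists_isCompact_nhds_injective {f : Fin 3 → X} (hf : Function.Injective f) :
    ∃ K ∈ 𝓝 f, IsCompact K ∧ ∀ g ∈ K, Function.Injective g := by
  obtain ⟨K, hK, hKs, hKc⟩ := local_compact_nhds ((isOpen_setOf_injective_fin 3).mem_nhds hf)
  exact ⟨K, hK, hKc, fun g hg => hKs hg⟩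

theorem IsThreeDiscontinuous.not_injective_of_tendsto (h3 : IsThreeDiscontinuous G X)
    {I : Type*} {l : Filter I} [l.NeBot] {γ : I → G} (hγ : Tendsto γ l cofinite)
    {u : Fin 3 → I → X} {x y : Fin 3 → X} (hu : ∀ j, Tendsto (u j) l (𝓝 (x j)))
    (hv : ∀ j, Tendsto (fun i => γ i • u j i) l (𝓝 (y j)))
    (hx : Function.Injective x) (hy : Function.Injective y) : False := by
  obtain ⟨K, hK, hKc, hKi⟩ := exists_isCompact_nhds_injective hx
  obtain ⟨L, hL, hLc, hLi⟩ := exists_isCompact_nhds_injective hy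
  have hu' : Tendsto (fun i j => u j i) l (𝓝 x) := tendsto_pi_nhds.2 hu
  have hv' : Tendsto (fun i => γ i • fun j => u j i) l (𝓝 y) := tendsto_pi_nhds.2 hv
  have hfin := h3.finite_of_isCompact hKc hLc hKi hLi
  obtain ⟨i, hi⟩ := ((hu'.eventually hK).and
    ((hv'.eventually hL).and (hγ hfin.compl_mem_cofinite))).exists
  exact hi.2.2 ⟨_, hi.1, hi.2.1⟩

theorem Fin.injective_three {α : Type*} {a b c : α} (hab : a ≠ b) (hac : a ≠ c) (hbc : b ≠ c) :
    Function.Injective ![a, b, c] := by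
  intro i j hij
  fin_cases i <;> fin_cases j <;> simp_all

theorem IsThreeDiscontinuous.exists_infinite_limit [Infinite X] (h3 : IsThreeDiscontinuous G X)
    {I : Type*} (l : Ultrafilter I) {γ : I → G} (hγ : Tendsto γ l cofinite) :
    ∃ p : X, {x : X | Tendsto (fun i => γ i • x) l (𝓝 p)}.Infinite := by
  -- Three distinct values of the pointwise limit `φ` would violate 3-discontinuity, so `φ` has
  -- finite range and an infinite fibre.
  choose φ hφ using fun x : X => l.exists_tendsto fun i => γ i • x
  have hfin : (Set.range φ).Finite := by
    by_contra hinf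
    obtain ⟨e⟩ : Nonempty (Fin 3 ↪ Set.range φ) := by
      have : Infinite (Set.range φ) := Set.infinite_coe_iff.2 hinf
      exact ⟨(Fin.valEmbedding).trans (Infinite.natEmbedding _)⟩
    choose s hs using fun j => (e j).2
    have hy : Function.Injective fun j => φ (s j) := fun i j hij =>
      e.injective (Subtype.ext (by simpa [hs] using hij))
    exact h3.not_injective_of_tendsto hγ (u := fun j _ => s j) (fun j => tendsto_const_nhds)
      (fun j => hφ (s j)) (fun i j hij => hy (congrArg φ hij)) hy
  have : Finite (Set.range φ) := hfin
  obtain ⟨p, hp⟩ := Finite.exists_infinite_fiber (Set.rangeFactorization φ)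
  refine ⟨p, (Set.infinite_coe_iff.1 hp).mono fun x hx => ?_⟩
  have : φ x = p := congrArg Subtype.val (show Set.rangeFactorization φ x = p from hx)
  exact this ▸ hφ x

/-- The convergence property of 3-discontinuous actions. -/
theorem IsThreeDiscontinuous.exists_attracting_repelling [Infinite X]
    (h3 : IsThreeDiscontinuous G X)
    {I : Type*} (l : Ultrafilter I) {γ : I → G} (hγ : Tendsto γ l cofinite) :
    ∃ p q : X, IsCollapsing l γ p q := by
  obtain ⟨p, hp⟩ := h3.exists_infinite_limit l hγ
  obtain ⟨q, hq⟩ := h3.exists_infinite_limit l (tendsto_inv_cofinite hγ)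
  refine ⟨p, q, fun u x y hu hv => ?_⟩
  by_contra! hne
  -- The triple `u, x', γ⁻¹ y'` tends to the distinct points `x, x', q` and its image to the
  -- distinct points `y, p, y'`.
  obtain ⟨x', hx', hx'n⟩ := hp.exists_notMem_finite (Set.toFinite {x, q})
  obtain ⟨y', hy', hy'n⟩ := hq.exists_notMem_finite (Set.toFinite {y, p})
  simp only [Set.mem_insert_iff, Set.mem_singleton_iff, not_or] at hx'n hy'n
  refine h3.not_injective_of_tendsto hγ (u := ![u, fun _ => x', fun i => (γ i)⁻¹ • y'])
    (x := ![x, x', q]) (y := ![y, p, y']) ?_ ?_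
    (Fin.injective_three (Ne.symm hx'n.1) hne.1 hx'n.2)
    (Fin.injective_three hne.2 (Ne.symm hy'n.1) (Ne.symm hy'n.2))
  · intro j
    fin_cases j
    exacts [hu, tendsto_const_nhds, hy']
  · intro j
    fin_cases j
    · exact hv
    · exact hx'
    · simp

end Convergence

/-! ### Poles, ping-pong and the parabolic case -/

section Poles

variable {G X I : Type*} [Group G] [TopologicalSpace X] [CompactSpace X] [MulAction G X]

theorem IsCollapsing.attracting_mem_limitSet [Infinite X] {l : Ultrafilter I} {γ : I → G}
    {p q : X} (h : IsCollapsing l γ p q) (hγ : Tendsto γ l cofinite) : p ∈ limitSet G X := by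
  obtain ⟨x, hx⟩ := exists_ne q
  obtain ⟨y, hy⟩ := l.exists_tendsto fun i => γ i • x
  rcases h _ x y tendsto_const_nhds hy with rfl | rfl
  · exact absurd rfl hx
  · exact mem_limitSet_of_tendsto hγ hy

theorem IsCollapsing.repelling_mem_limitSet [Infinite X] {l : Ultrafilter I} {γ : I → G}
    {p q : X} (h : IsCollapsing l γ p q) (hγ : Tendsto γ l cofinite) : q ∈ limitSet G X :=
  h.inv.attracting_mem_limitSet (tendsto_inv_cofinite hγ)

/-- Uniformity comes from compactness: counterexamples `u i` would have limits contradicting the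
collapsing condition. -/
theorem IsCollapsing.eventually_smul_mem [T2Space X] {l : Ultrafilter I} {γ : I → G} {p q : X}
    (h : IsCollapsing l γ p q) {P Q : Set X} (hP : P ∈ 𝓝 p) (hQ : Q ∈ 𝓝 q) :
    ∀ᶠ i in l, ∀ x, x ∉ Q → γ i • x ∈ P := by
  by_contra hne
  rw [← Ultrafilter.eventually_not] at hne
  have : ∀ i, ∃ x, (¬ ∀ x, x ∉ Q → γ i • x ∈ P) → x ∉ Q ∧ γ i • x ∉ P := by
    intro i
    by_cases hi : ∀ x, x ∉ Q → γ i • x ∈ P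
    · exact ⟨p, fun h => absurd hi h⟩
    · obtain ⟨x, hx⟩ := not_forall.1 hi
      exact ⟨x, fun _ => Classical.not_imp.1 hx⟩
  choose u hu using this
  obtain ⟨x, hx⟩ := l.exists_tendsto u
  obtain ⟨y, hy⟩ := l.exists_tendsto fun i => γ i • u i
  rcases h u x y hx hy with rfl | rfl
  · obtain ⟨i, hi, hi'⟩ := (hne.and (hx.eventually hQ)).exists
    exact (hu i hi).1 hi'
  · obtain ⟨i, hi, hi'⟩ := (hne.and (hy.eventually hP)).exists
    exact (hu i hi).2 hi'

/-- Positive powers of `f` keep `z` inside `P`, so `f` has infinite order; the powers of its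
conjugate in `H` then accumulate on `c • P`. -/
theorem exists_mem_limitSet_of_pingPong [ContinuousConstSMul G X] {H : Subgroup G} {c f : G}
    (hc : c * f * c⁻¹ ∈ H)
    {P Q : Set X} (hP : IsClosed P) (hPQ : Disjoint P Q) (hf : ∀ x, x ∉ Q → f • x ∈ P)
    {z : X} (hzP : z ∉ P) (hzQ : z ∉ Q) : ∃ y ∈ P, c • y ∈ limitSet H X := by
  have hpow : ∀ n : ℕ, f ^ (n + 1) • z ∈ P := by
    intro n
    induction n with
    | zero => simpa using hf z hzQ
    | succ n ih =>
      rw [pow_succ', mul_smul]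
      exact hf _ (Set.disjoint_left.1 hPQ ih)
  set h : H := ⟨c * f * c⁻¹, hc⟩ with hh
  have hcoe : ∀ n : ℕ, ((h ^ n : H) : G) = c * f ^ n * c⁻¹ := by
    intro n
    rw [SubmonoidClass.coe_pow, hh, conj_pow]
  have hinj : Function.Injective fun n : ℕ => h ^ n := by
    rw [injective_pow_iff_not_isOfFinOrder, isOfFinOrder_iff_pow_eq_one]
    rintro ⟨n, hn, hn1⟩
    have h1 : f ^ n = 1 := by
      have := hcoe n
      rw [hn1, OneMemClass.coe_one, eq_comm, conj_eq_one_iff] at this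
      exact this
    obtain ⟨m, rfl⟩ := Nat.exists_eq_succ_of_ne_zero hn.ne'
    exact hzP (by simpa [h1] using hpow m)
  have hinj' : Function.Injective fun n : ℕ => h ^ (n + 1) := fun m n hmn =>
    Nat.succ_injective (hinj hmn)
  have htend : Tendsto (fun n : ℕ => h ^ (n + 1)) (hyperfilter ℕ) cofinite :=
    hinj'.tendsto_cofinite.mono_left hyperfilter_le_cofinite
  obtain ⟨y, hy⟩ := (hyperfilter ℕ).exists_tendsto fun n => f ^ (n + 1) • z
  refine ⟨y, hP.mem_of_tendsto hy (Eventually.of_forall hpow), ?_⟩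
  refine mem_limitSet_of_tendsto htend (x := c • z) ?_
  convert hy.const_smul c using 2 with n
  rw [Subgroup.smul_def, hcoe, smul_smul, smul_smul]
  simp

theorem exists_isClosed_nhds_disjoint [T2Space X] {a b z : X} (hab : a ≠ b)
    (haz : a ≠ z) (hbz : b ≠ z) :
    ∃ P ∈ 𝓝 a, ∃ Q ∈ 𝓝 b, IsClosed P ∧ IsClosed Q ∧ Disjoint P Q ∧ z ∉ P ∧ z ∉ Q := by
  obtain ⟨u, hau, hu, v, hbv, hv, huv⟩ := exists_open_nhds_disjoint_closure hab
  obtain ⟨P, hP, hPc, hPs⟩ := exists_mem_nhds_isClosed_subset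
    (inter_mem (hu.mem_nhds hau) (compl_singleton_mem_nhds haz))
  obtain ⟨Q, hQ, hQc, hQs⟩ := exists_mem_nhds_isClosed_subset
    (inter_mem (hv.mem_nhds hbv) (compl_singleton_mem_nhds hbz))
  exact ⟨P, hP, Q, hQ, hPc, hQc,
    huv.mono (fun x hx => subset_closure (hPs hx).1) (fun x hx => subset_closure (hQs hx).1),
    fun hz => (hPs hz).2 rfl, fun hz => (hQs hz).2 rfl⟩

/-- A subgroup with a single limit point has no elements whose conjugates escape to infinity
while almost fixing two different points. -/
theorem IsCollapsing.false_of_conj [T2Space X] [Infinite X] [ContinuousConstSMul G X]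
    {H : Subgroup G} {p : X} (hH : limitSet H X = {p}) {l : Ultrafilter I} {c f : I → G}
    (hc : ∀ i, c i * f i * (c i)⁻¹ ∈ H) {a b : X} (hf : IsCollapsing l f a b)
    {u v : I → X} {w r : X} (hwr : w ≠ r)
    (hu : Tendsto u l (𝓝 w)) (hfu : Tendsto (fun i => f i • u i) l (𝓝 w))
    (hv : Tendsto v l (𝓝 r)) (hfv : Tendsto (fun i => f i • v i) l (𝓝 r)) : False := by
  -- With a single pole, both `w` and `r` would equal it.
  have hab : a ≠ b := by
    have h1 := hf u w w hu hfu
    have h2 := hf v r r hv hfv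
    rintro rfl
    exact hwr ((h1.elim id id).trans (h2.elim id id).symm)
  obtain ⟨z, hz⟩ := (Set.toFinite {a, b}).exists_notMem
  simp only [Set.mem_insert_iff, Set.mem_singleton_iff, not_or] at hz
  obtain ⟨P, hP, Q, hQ, hPc, hQc, hPQ, hzP, hzQ⟩ :=
    exists_isClosed_nhds_disjoint hab (Ne.symm hz.1) (Ne.symm hz.2)
  obtain ⟨i, hi⟩ := (hf.eventually_smul_mem hP hQ).exists
  obtain ⟨y, hy, hyΛ⟩ := exists_mem_limitSet_of_pingPong (hc i) hPc hPQ hi hzP hzQ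
  -- The inverse plays ping-pong with `P` and `Q` exchanged, giving a second limit point of `H`.
  obtain ⟨y', hy', hyΛ'⟩ := exists_mem_limitSet_of_pingPong (H := H) (c := c i) (f := (f i)⁻¹)
    (by simpa [mul_assoc] using H.inv_mem (hc i)) hQc hPQ.symm
    (fun x hx => by_contra fun hx' => hx (by simpa using hi _ hx')) hzQ hzP
  rw [hH, Set.mem_singleton_iff] at hyΛ hyΛ'
  have := MulAction.injective (c i) (hyΛ.trans hyΛ'.symm)
  exact Set.disjoint_left.1 hPQ hy (this ▸ hy')

/-- A global fixed point of the infinite group `H` must be a pole of any collapsing family in `H`,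
and both poles lie in the limit set of `H`. -/
theorem eq_of_forall_smul_eq [T2Space X] [Infinite X] (h3 : IsThreeDiscontinuous G X)
    {H : Subgroup G} {p k : X} (hH : limitSet H X = {p}) (hk : ∀ h : H, h • k = k) : k = p := by
  have : Infinite H := infinite_of_limitSet_nonempty (X := X) (hH ▸ Set.singleton_nonempty p)
  have hid : Tendsto (id : H → H) (hyperfilter H) cofinite := hyperfilter_le_cofinite
  obtain ⟨a, b, hab⟩ := h3.exists_attracting_repelling (hyperfilter H) (γ := ((↑) : H → G))
    (Subtype.val_injective.tendsto_cofinite.comp hid)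
  have hab' : IsCollapsing (hyperfilter H) (id : H → H) a b := hab
  have ha := hab'.attracting_mem_limitSet hid
  have hb := hab'.repelling_mem_limitSet hid
  rw [hH, Set.mem_singleton_iff] at ha hb
  rcases hab' (fun _ => k) k k tendsto_const_nhds (by simp [hk]) with h | h
  exacts [h.trans hb, h.trans ha]

/-- After reduction to a single limit point `p`, the limit `k` of `γ i w` is shown to be fixed by
all of `H`, hence equal to `p`, although `k` lies in `K`. -/
theorem false_of_escaping_orbit [T2Space X] [Infinite X] [ContinuousConstSMul G X]
    (h3 : IsThreeDiscontinuous G X) {H : Subgroup G} {l : Ultrafilter I} {γ : I → G}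
    (hγ : Tendsto γ l cofinite) {w : X} {W K C : Set X} (hW : W ∈ 𝓝 w)
    (hγW : ∀ i, ∀ x ∈ limitSet H X, (γ i)⁻¹ • x ∉ W)
    (hK : IsClosed K) (hKΛ : Disjoint K (limitSet H X)) (hγK : ∀ i, γ i • w ∈ K)
    (hC : IsClosed C) (hCΛ : C ∩ limitSet G X ⊆ limitSet H X)
    {a : X} (ha : a ∈ discontinuityDomain G X) (hγa : ∀ i, γ i • a ∈ C) : False := by
  obtain ⟨p, q, hpq⟩ := h3.exists_attracting_repelling l hγ
  have hpG := hpq.attracting_mem_limitSet hγ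
  have hqG := hpq.repelling_mem_limitSet hγ
  have hpH : p ∈ limitSet H X := by
    obtain ⟨y, hy⟩ := l.exists_tendsto fun i => γ i • a
    rcases hpq _ a y tendsto_const_nhds hy with rfl | rfl
    · exact absurd ha hqG
    · exact hCΛ ⟨hC.mem_of_tendsto hy (Eventually.of_forall hγa), hpG⟩
  obtain ⟨k, hk⟩ := l.exists_tendsto fun i => γ i • w
  have hkp : k ≠ p := by
    rintro rfl
    exact Set.disjoint_left.1 hKΛ (hK.mem_of_tendsto hk (Eventually.of_forall hγK)) hpH
  have hwq : w = q := (hpq _ w k tendsto_const_nhds hk).resolve_right hkp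
  have hH : limitSet H X = {p} := by
    refine Set.eq_singleton_iff_unique_mem.2 ⟨hpH, fun x hx => by_contra fun hxp => ?_⟩
    obtain ⟨y, hy⟩ := l.exists_tendsto fun i => (γ i)⁻¹ • x
    have hyw : y = w :=
      ((hpq.inv _ x y tendsto_const_nhds hy).resolve_left hxp).trans hwq.symm
    obtain ⟨i, hi⟩ := (hy.eventually (hyw ▸ hW)).exists
    exact hγW i x hx hi
  have hfix : ∀ h : H, h • p = p := fun h => by
    have := (smul_mem_limitSet_iff h).2 hpH
    rwa [hH] at this
  obtain ⟨r, hr⟩ := l.exists_tendsto fun i => (γ i)⁻¹ • p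
  have hwr : w ≠ r := by
    rintro rfl
    obtain ⟨i, hi⟩ := (hr.eventually hW).exists
    exact hγW i p hpH hi
  refine hkp (eq_of_forall_smul_eq h3 hH fun h => ?_)
  -- `f i` fixes `(γ i)⁻¹ p`, which tends to `r ≠ w`, and nearly fixes `w`: the limit of `γ i f i w`
  -- is `h k ≠ p`.
  set f : I → G := fun i => (γ i)⁻¹ * h * γ i with hf
  have hfw : Tendsto (fun i => f i • w) l (𝓝 w) := by
    obtain ⟨y, hy⟩ := l.exists_tendsto fun i => f i • w
    have hhk : Tendsto (fun i => γ i • f i • w) l (𝓝 (h • k)) := by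
      convert hk.const_smul h using 2 with i
      simp [hf, mul_smul, Subgroup.smul_def]
    rcases hpq _ y _ hy hhk with rfl | hy'
    · rwa [← hwq] at hy
    · exact absurd (MulAction.injective h (hy'.trans (hfix h).symm)) hkp
  -- Either `f` escapes every finite set, and ping-pong gives two limit points of `H`, or it is
  -- eventually a constant `g` fixing `w`, whence `h k = k`.
  rcases (l.map f).le_cofinite_or_eq_pure with hcof | ⟨g, hg⟩
  · obtain ⟨a', b', hab⟩ := h3.exists_attracting_repelling l (γ := f) hcof
    refine (hab.false_of_conj hH (c := γ) (fun i => ?_) hwr tendsto_const_nhds hfw hr ?_).elim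
    · simp [hf, mul_assoc]
    · convert hr using 2 with i
      have := hfix h
      rw [Subgroup.smul_def] at this
      simp [hf, mul_smul, this]
  · have hev : ∀ᶠ i in l, f i = g := by
      have : {g} ∈ l.map f := by rw [hg]; exact Set.mem_singleton g
      exact this
    have hgw : g • w = w := tendsto_nhds_unique
      (tendsto_const_nhds.congr' (hev.mono fun i hi => by rw [hi])) hfw
    refine tendsto_nhds_unique (hk.const_smul h) (hk.congr' (hev.mono fun i hi => ?_))
    calc γ i • w = γ i • f i • w := by rw [hi, hgw]
      _ = h • γ i • w := by simp [hf, mul_smul, Subgroup.smul_def]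

end Poles

/-! ### Orbit finiteness and the main theorem -/

theorem actsCocompactlyOn_of_finite {G X : Type*} [Group G] [TopologicalSpace X] [MulAction G X]
    {Y : Set X} (hY : Y.Finite) (hinv : ∀ (g : G), ∀ x ∈ Y, g • x ∈ Y) :
    ActsCocompactlyOn G Y := by
  refine ⟨Y, hY.isCompact, Set.Subset.antisymm (Set.iUnion_subset fun g => ?_) fun x hx => ?_⟩
  · rintro _ ⟨x, hx, rfl⟩
    exact hinv g x hx
  · exact Set.mem_iUnion.2 ⟨1, x, hx, one_smul G x⟩

theorem IsGFinite.exists_finite {G X : Type*} [Group G] [MulAction G X] {M : Set X}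
    (h : IsGFinite G M) :
    ∃ F ⊆ M, F.Finite ∧ ∀ x ∈ M, ∃ y ∈ F, x ∈ MulAction.orbit G y := by
  obtain ⟨F, hFM, hF⟩ := Set.exists_subset_bijOn M (MulAction.orbit G)
  refine ⟨F, hFM, ?_, fun x hx => ?_⟩
  · refine Set.Finite.of_finite_image ?_ hF.injOn
    rw [hF.image_eq]
    refine Set.Finite.subset h ?_
    rintro _ ⟨x, hx, rfl⟩
    exact ⟨x, hx, rfl⟩
  · obtain ⟨y, hy, hyx⟩ := hF.surjOn ⟨x, hx, rfl⟩
    exact ⟨y, hy, hyx ▸ MulAction.mem_orbit_self x⟩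

/-- A set that is not `H`-finite inside a `G`-finite one contains infinitely many points of a
single `G`-orbit, in pairwise different `H`-orbits. -/
theorem IsGFinite.exists_infinite_injOn {G X : Type*} [Group G] [MulAction G X] {M B : Set X}
    (hM : IsGFinite G M) (hB : B ⊆ M) {H : Subgroup G} (hBH : ¬ IsGFinite H B) :
    ∃ a ∈ M, ∃ S : Set G, S.Infinite ∧ (∀ g ∈ S, g • a ∈ B) ∧
      Set.InjOn (fun g => MulAction.orbit H (g • a)) S := by
  obtain ⟨F, hFM, hF, hcover⟩ := hM.exists_finite
  have : ∃ a ∈ F, ((fun g : G => MulAction.orbit H (g • a)) '' {g | g • a ∈ B}).Infinite := by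
    by_contra! hfin
    refine hBH ((hF.biUnion fun a ha => hfin a ha).subset ?_)
    rintro _ ⟨x, hx, rfl⟩
    obtain ⟨a, ha, g, rfl⟩ := hcover x (hB hx)
    exact Set.mem_biUnion ha ⟨g, hx, rfl⟩
  obtain ⟨a, ha, hinf⟩ := this
  obtain ⟨S, hS, hbij⟩ := Set.exists_subset_bijOn {g : G | g • a ∈ B}
    fun g => MulAction.orbit H (g • a)
  refine ⟨a, hFM ha, S, fun hfin => hinf ?_, hS, hbij.injOn⟩
  rw [← hbij.image_eq]
  exact hfin.image _

theorem IsGFinite.subgroup_of_isDynamicallyBounded {G X : Type*} [Group G] [TopologicalSpace X]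
    [CompactSpace X] [T2Space X] [MulAction G X] [ContinuousConstSMul G X] [Infinite X]
    (h3 : IsThreeDiscontinuous G X) (hfinite : IsGFinite G (discontinuityDomain G X))
    {H : Subgroup G} (hbounded : IsDynamicallyBounded X H)
    {K V : Set X} (hK : IsClosed K) (hKΛ : Disjoint K (limitSet H X))
    (hcover : ∀ x ∈ limitSet G X \ limitSet H X, ∃ h : H, h • x ∈ K)
    (hV : IsOpen V) (hVH : ∀ (h : H) (x : X), h • x ∈ V → x ∈ V)
    (hTV : limitSet G X \ limitSet H X ⊆ V) :
    IsGFinite H (discontinuityDomain G X \ V) := by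
  by_contra hne
  obtain ⟨a, ha, S, hS, hSB, hSinj⟩ := hfinite.exists_infinite_injOn Set.sdiff_subset hne
  -- Inverses turn distinct `H`-orbits of `g a` into distinct left cosets of `H`.
  obtain ⟨S₀, hS₀, hS₀inf, ⟨w, hwT⟩, hw⟩ := hbounded S⁻¹ (by simpa using hS) (by
    intro s hs t ht hst
    refine inv_injective (hSinj hs ht ?_)
    rw [MulAction.orbit_eq_iff]
    have hmem : s⁻¹ * t ∈ H := QuotientGroup.eq.1 hst
    refine ⟨⟨s⁻¹ * t, hmem⟩, ?_⟩
    simp [Subgroup.smul_def, mul_smul])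
  obtain ⟨W, hW, hWD⟩ := mem_nhds_subtype _ _ _ |>.1 (mem_interior_iff_mem_nhds.1 hw)
  have havoid : ∀ s ∈ S₀, ∀ x ∈ limitSet H X, s • x ∉ W := by
    intro s hs x hx hxW
    have hxT : s • x ∈ limitSet G X :=
      (smul_mem_limitSet_iff s).2 (limitSet_subgroup_subset H hx)
    exact hWD (show (⟨s • x, hxT⟩ : limitSet G X) ∈ Subtype.val ⁻¹' W from hxW)
      (Set.mem_biUnion hs ⟨x, hx, rfl⟩)
  have hchoose : ∀ s : S₀, ∃ h : H, h • (s : G)⁻¹ • w ∈ K := by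
    intro s
    refine hcover _ ⟨(smul_mem_limitSet_iff _).2 hwT, fun hmem => ?_⟩
    exact havoid s s.2 _ hmem (by simpa using mem_of_mem_nhds hW)
  choose h hh using hchoose
  have hinf : Infinite S₀ := hS₀inf.to_subtype
  -- The correction by `h s` does not change the `H`-orbit of `s⁻¹ a`, and these orbits are
  -- distinct.
  have hinj : Function.Injective fun s : S₀ => (h s : G) * (s : G)⁻¹ := by
    intro s t hst
    refine Subtype.ext (inv_injective (hSinj (hS₀ s.2) (hS₀ t.2) ?_))
    have h1 : ∀ s : S₀, MulAction.orbit H (((s : G)⁻¹) • a) =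
        MulAction.orbit H (((h s : G) * (s : G)⁻¹) • a) := fun s => by
      rw [mul_smul]
      exact (MulAction.orbit_smul (h s) ((s : G)⁻¹ • a)).symm
    exact (h1 s).trans ((congrArg (fun g : G => MulAction.orbit H (g • a)) hst).trans (h1 t).symm)
  refine false_of_escaping_orbit h3 (H := H) (l := hyperfilter S₀) (γ := fun s => h s * (s : G)⁻¹)
    (hinj.tendsto_cofinite.mono_left hyperfilter_le_cofinite) hW ?_ hK hKΛ ?_
    hV.isClosed_compl ?_ ha ?_
  · intro s x hx
    rw [mul_inv_rev, inv_inv, mul_smul]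
    exact havoid s s.2 _ ((smul_mem_limitSet_iff (h s)⁻¹).2 hx)
  · intro s
    rw [mul_smul]
    exact hh s
  · rintro x ⟨hxV, hxT⟩
    exact by_contra fun hx => hxV (hTV ⟨hxT, hx⟩)
  · intro s hs
    rw [mul_smul] at hs
    exact (hSB _ (hS₀ s.2)).2 (hVH (h s) _ hs)

theorem mainTheorem6 {G X : Type*} [Group G] [TopologicalSpace X] [CompactSpace X] [T2Space X]
    [MulAction G X] [ContinuousConstSMul G X]
    (h3 : IsThreeDiscontinuous G X)
    (hdiscrete : DiscreteTopology (discontinuityDomain G X))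
    (hfinite : IsGFinite G (discontinuityDomain G X))
    (H : Subgroup G)
    (hbounded : IsDynamicallyBounded X H)
    (hcocompact : ActsCocompactlyOn H (limitSet G X \ limitSet H X)) :
    ActsCocompactlyOn H (Set.univ \ limitSet H X) := by
  have hinv : ∀ (h : H), ∀ x ∈ Set.univ \ limitSet H X, h • x ∈ Set.univ \ limitSet H X :=
    fun h x hx => ⟨trivial, mt (smul_mem_limitSet_iff h).1 hx.2⟩
  -- The convergence property needs an infinite space.
  rcases finite_or_infinite X with hX | hX
  · exact actsCocompactlyOn_of_finite (Set.toFinite _) hinv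
  obtain ⟨K, hK, hKU⟩ := hcocompact
  have hKsub : K ⊆ limitSet G X \ limitSet H X := fun x hx => by
    rw [← hKU]
    exact Set.mem_iUnion.2 ⟨1, x, hx, one_smul H x⟩
  obtain ⟨N, hN, hKN, hNO⟩ := exists_compact_between hK
    (isClosed_limitSet (G := H) (X := X)).isOpen_compl fun x hx => (hKsub hx).2
  set V : Set X := ⋃ h : H, h • interior N with hVdef
  have hVO : IsOpen V := isOpen_iUnion fun h => isOpen_interior.smul h
  have hTV : limitSet G X \ limitSet H X ⊆ V := by
    rw [← hKU]
    exact Set.iUnion_mono fun h => Set.smul_set_mono hKN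
  have hfin := hfinite.subgroup_of_isDynamicallyBounded h3 hbounded hK.isClosed
    (Set.disjoint_left.2 fun x hx => (hKsub hx).2) (fun x hx => by
      rw [← hKU] at hx
      obtain ⟨h, y, hy, rfl⟩ := Set.mem_iUnion.1 hx
      exact ⟨h⁻¹, by simpa using hy⟩) hVO (fun h x hx => by
      obtain ⟨h', y, hy, hyx⟩ := Set.mem_iUnion.1 hx
      refine Set.mem_iUnion.2 ⟨h⁻¹ * h', y, hy, ?_⟩
      simp only at hyx ⊢
      rw [mul_smul, hyx, inv_smul_smul]) hTV
  obtain ⟨F, hFB, hF, hFcover⟩ := hfin.exists_finite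
  refine ⟨N ∪ F, hN.union hF.isCompact, Set.Subset.antisymm (Set.iUnion_subset fun h => ?_) ?_⟩
  · rintro _ ⟨x, hx, rfl⟩
    refine hinv h x ⟨trivial, ?_⟩
    rcases hx with hx | hx
    · exact hNO hx
    · exact fun hxΛ => limitSet_subgroup_subset H hxΛ (hFB hx).1
  · intro x hx
    by_cases hxV : x ∈ V
    · exact Set.iUnion_mono (fun h => Set.smul_set_mono
        (interior_subset.trans Set.subset_union_left)) hxV
    · have hxA : x ∈ discontinuityDomain G X := by_contra fun hxT => hxV (hTV ⟨hxT, hx.2⟩)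
      obtain ⟨y, hy, h, rfl⟩ := hFcover x ⟨hxA, hxV⟩
      exact Set.mem_iUnion.2 ⟨h, y, Or.inr hy, rfl⟩
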